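/- All map germs are of class $C^\infty$. Let $p\ge 0$ and let $G\subset GL(p,\mathbb R)$ be a connected linear Lie group, i.e. a connected closed subgroup, with Lie algebra $\mathfrak g=T_IG\subset M_p(\mathbb R)$. Notation. $\mathrm{Diff}(n)$ is the group of diffeomorphism germs $(\mathbb R^n,0)\to(\mathbb R^n,0)$. $\mathrm{Diff}[G](p)$ is the set of $\psi\in\mathrm{Diff}(p)$ whose Jacobi matrix $J_\psi(y)$ lies in $G$ for all $y$ near $0$. $\mathrm{Diff}_0[G](p)$ is the set of $\psi\in \mathrm{Diff}[G](p)$ for which there is a map $\Psi$ into $\mathbb R^p$, smooth on a neighbourhood of $\{0\}\times[0,1]$ in $\mathbb R^p\times\mathbb R$, such that the germs $\psi_t=\Psi(\cdot,t)$ at $0$ satisfy $\psi_t\in\mathrm{Diff}[G](p)$ for all $t\in[0,1]$, $\psi_0=\mathrm{id}$ and $\psi_1=\psi$. $G$ is regarded as a set of germs by $A\mapsto\psi_A$, $\psi_A(y)=Ay$. $\theta[G]_0(p)$ is the real vector space of germs at $0\in\mathbb R^p$ of smooth vector fields $\eta=\sum_i\eta_i\,\partial/\partial y_i$ with $\eta(0)=0$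 and $\left(\partial\eta_i/\partial y_j(y)\right)_{i,j}\in\mathfrak g$ for all $y$ near $0$. $\mathfrak M_n\theta(n)$ is the space of germs at $0\in\mathbb R^n$ of smooth vector fields vanishing at $0$. For a map germ $f:(\mathbb R^n,0)\to(\mathbb R^p,0)$ put $$T\mathcal A[G](f)=\{df\circ\zeta+\eta\circ f \mid \zeta\in\mathfrak M_n\theta(n),\ \eta\in\theta[G]_0(p)\},$$ $$T(\mathcal R\times G)(f)=\{df\circ\zeta+X f \mid \zeta\in\mathfrak M_n\theta(n),\ X\in\mathfrak g\}.$$ Map germs $f,g:(\mathbb R^n,0)\to(\mathbb R^p,0)$ are $\mathcal A_0[G]$-equivalent if $f\circ\phi=\psi\circ g$ for some $\phi\in\mathrm{Diff}(n)$ and $\psi\in\mathrm{Diff}_0[G](p)$; they are $G$-congruent (i.e. $\mathcal R\times G$-equivalent) if $f\circ\phi=\psi_A\circ g$ for some $\phi\in\mathrm{Diff}(n)$ and $A\in G$. Corollary 7.2. Suppose that at least one of the following conditions holds: (i) $\mathfrak g\cong\theta[G]_0(p)$ as real vector spaces; (ii) for every $\eta=\sum_i\eta_i\,\partial/\partial y_i\in\theta[G]_0(p)$,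 all $\eta_i$ are germs of linear functions; (iii) $\mathrm{Diff}_0[G](p)=G$. Then, for every $n\ge 0$: (1) $T\mathcal A[G](f)=T(\mathcal R\times G)(f)$ for every map germ $f:(\mathbb R^n,0)\to(\mathbb R^p,0)$; (2) map germs $f,g:(\mathbb R^n,0)\to(\mathbb R^p,0)$ are $\mathcal A_0[G]$-equivalent if and only if they are $G$-congruent. -/

import Mathlib

open Filter Topology Set
open scoped ContDiff Matrix

namespace GeomEquiv

/-- The space `ℝⁿ`. Only its smooth structure matters, so the choice of norm is irrelevant. -/
abbrev E (n : ℕ) : Type := Fin n → ℝ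

/-- The real vector space of all germs at `0` of (arbitrary) maps `ℝⁿ → ℝᵖ`. -/
abbrev Gm (n p : ℕ) : Type := Germ (𝓝 (0 : E n)) (E p)

/-- `f` is of class `C^∞` on a neighbourhood of `0` (the neighbourhood does not depend on the
order of differentiation), i.e. `f` represents a smooth map germ `(ℝⁿ, 0) → ℝᵖ`. -/
def SmoothNear {n p : ℕ} (f : E n → E p) : Prop :=
  ∀ᶠ x in 𝓝 (0 : E n), ContDiffAt ℝ ∞ f x

/-- `f` represents a smooth map germ `(ℝⁿ, 0) → (ℝᵖ, 0)`. -/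
def IsMapGerm {n p : ℕ} (f : E n → E p) : Prop :=
  SmoothNear f ∧ f 0 = 0

theorem SmoothNear.diff {n p : ℕ} {f : E n → E p} (hf : SmoothNear f) :
    ∀ᶠ x in 𝓝 (0 : E n), DifferentiableAt ℝ f x :=
  hf.mono fun _ h => h.differentiableAt (by simp)

theorem IsMapGerm.tendsto {n p : ℕ} {f : E n → E p} (hf : IsMapGerm f) :
    Tendsto f (𝓝 0) (𝓝 0) := by
  have h := hf.1.self_of_nhds.continuousAt.tendsto
  rwa [hf.2] at h

/-- The Jacobi matrix `(∂fᵢ/∂xⱼ)(x)`. -/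
noncomputable def jac {n p : ℕ} (f : E n → E p) (x : E n) : Matrix (Fin p) (Fin n) ℝ :=
  LinearMap.toMatrix' (fderiv ℝ f x : E n →ₗ[ℝ] E p)

/-- `φ` represents a diffeomorphism germ `(ℝⁿ, 0) → (ℝⁿ, 0)`. -/
def IsDiffeoGerm {n : ℕ} (φ : E n → E n) : Prop :=
  IsMapGerm φ ∧ ∃ χ : E n → E n, IsMapGerm χ ∧
    (∀ᶠ x in 𝓝 (0 : E n), χ (φ x) = x) ∧ (∀ᶠ x in 𝓝 (0 : E n), φ (χ x) = x)

/-- `ψ` represents an element of `Diff[G](p)`: a diffeomorphism germ of `(ℝᵖ, 0)` whose Jacobi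
matrix lies in `G` at every point near `0`. -/
def IsDiffG {p : ℕ} (G : Subgroup (GL (Fin p) ℝ)) (ψ : E p → E p) : Prop :=
  IsDiffeoGerm ψ ∧ ∀ᶠ y in 𝓝 (0 : E p), ∃ A ∈ G, (A : Matrix (Fin p) (Fin p) ℝ) = jac ψ y

/-- `ψ` represents an element of `Diff₀[G](p)`: an element of `Diff[G](p)` which is joined to the
identity by a family `ψ_t = Ψ(·, t)`, `t ∈ [0,1]`, of elements of `Diff[G](p)`, where `Ψ` is
smooth on a neighbourhood of `{0} × [0,1]` in `ℝᵖ × ℝ`. -/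
def IsDiffZeroG {p : ℕ} (G : Subgroup (GL (Fin p) ℝ)) (ψ : E p → E p) : Prop :=
  IsDiffG G ψ ∧ ∃ Ψ : E p × ℝ → E p,
    (∀ᶠ z in 𝓝ˢ (({0} : Set (E p)) ×ˢ Icc (0 : ℝ) 1), ContDiffAt ℝ ∞ Ψ z) ∧
    (∀ t ∈ Icc (0 : ℝ) 1, IsDiffG G fun y => Ψ (y, t)) ∧
    (∀ᶠ y in 𝓝 (0 : E p), Ψ (y, 0) = y) ∧
    (∀ᶠ y in 𝓝 (0 : E p), Ψ (y, 1) = ψ y)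

/-- `Diff₀[G](p)` as a set of germs. -/
def DiffZero {p : ℕ} (G : Subgroup (GL (Fin p) ℝ)) : Set (Gm p p) :=
  {γ | ∃ ψ : E p → E p, IsDiffZeroG G ψ ∧ γ = (ψ : Gm p p)}

/-- `G`, viewed as the set of the germs at `0` of the linear maps `ψ_A : y ↦ A y`, `A ∈ G`. -/
def linearGerms {p : ℕ} (G : Subgroup (GL (Fin p) ℝ)) : Set (Gm p p) :=
  {γ | ∃ A ∈ G, γ = ((fun y : E p => (A : Matrix (Fin p) (Fin p) ℝ) *ᵥ y : E p → E p) : Gm p p)}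

/-- `𝒜₀[G]`-equivalence of (representatives of) map germs: `f ∘ φ = ψ ∘ g` as germs. -/
def AZeroEquiv {n p : ℕ} (G : Subgroup (GL (Fin p) ℝ)) (f g : E n → E p) : Prop :=
  ∃ (φ : E n → E n) (ψ : E p → E p), IsDiffeoGerm φ ∧ IsDiffZeroG G ψ ∧
    ∀ᶠ x in 𝓝 (0 : E n), f (φ x) = ψ (g x)

/-- `G`-congruence, i.e. `ℛ × G`-equivalence: `f ∘ φ = A · g` as germs. -/
def GCongruent {n p : ℕ} (G : Subgroup (GL (Fin p) ℝ)) (f g : E n → E p) : Prop :=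
  ∃ (φ : E n → E n), IsDiffeoGerm φ ∧ ∃ A ∈ G,
    ∀ᶠ x in 𝓝 (0 : E n), f (φ x) = (A : Matrix (Fin p) (Fin p) ℝ) *ᵥ g x

/-- The Lie algebra `𝔤 = T_I G ⊆ M_p(ℝ)`: the velocities at `I` of the smooth curves in `G`
through `I` (smoothness and derivatives of matrix-valued curves are taken entrywise). -/
def lieAlg {p : ℕ} (G : Subgroup (GL (Fin p) ℝ)) : Submodule ℝ (Matrix (Fin p) (Fin p) ℝ) where
  carrier := {X | ∃ c : ℝ → GL (Fin p) ℝ, (∀ t, c t ∈ G) ∧ c 0 = 1 ∧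
    (∀ i j, ContDiff ℝ ∞ fun t => (c t : Matrix (Fin p) (Fin p) ℝ) i j) ∧
    ∀ i j, HasDerivAt (fun t => (c t : Matrix (Fin p) (Fin p) ℝ) i j) (X i j) 0}
  zero_mem' := ⟨fun _ => 1, fun _ => G.one_mem, rfl, fun _ _ => contDiff_const,
    fun i j => by simpa using hasDerivAt_const (0 : ℝ) _⟩
  add_mem' := by
    rintro X Y ⟨c, hc, hc0, hcs, hcd⟩ ⟨d, hd, hd0, hds, hdd⟩
    have e : ∀ i j, (fun t => ((c t * d t : GL (Fin p) ℝ) : Matrix (Fin p) (Fin p) ℝ) i j) =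
        fun t => ∑ k, (c t : Matrix (Fin p) (Fin p) ℝ) i k *
          (d t : Matrix (Fin p) (Fin p) ℝ) k j := fun i j => funext fun t => Matrix.mul_apply
    refine ⟨fun t => c t * d t, fun t => G.mul_mem (hc t) (hd t), by simp [hc0, hd0],
      fun i j => ?_, fun i j => ?_⟩
    · rw [e]
      exact ContDiff.sum fun k _ => (hcs i k).mul (hds k j)
    · rw [e]
      have h := HasDerivAt.fun_sum (u := Finset.univ)
        fun k (_ : k ∈ Finset.univ) => (hcd i k).mul (hdd k j)
      refine h.congr_deriv ?_
      simp [hc0, hd0, Finset.sum_add_distrib, Matrix.one_apply]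
  smul_mem' := by
    rintro a X ⟨c, hc, hc0, hcs, hcd⟩
    refine ⟨fun t => c (a * t), fun t => hc _, by simp [hc0], ?_, ?_⟩
    · intro i j
      exact (hcs i j).comp (contDiff_const.mul contDiff_id)
    · intro i j
      have h1 : HasDerivAt (fun t : ℝ => a * t) a 0 := by
        simpa using (hasDerivAt_id (0 : ℝ)).const_mul a
      have h2 : HasDerivAt (fun t => (c t : Matrix (Fin p) (Fin p) ℝ) i j) (X i j) (a * 0) := by
        simpa using hcd i j
      have h := h2.comp (0 : ℝ) h1
      simpa [Function.comp_def, mul_comm] using h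

/-- `𝔐_n θ(n)`: the germs of smooth vector fields on `(ℝⁿ, 0)` vanishing at `0`. -/
def thetaZero (n : ℕ) : Submodule ℝ (Gm n n) where
  carrier := {γ | ∃ ζ : E n → E n, SmoothNear ζ ∧ ζ 0 = 0 ∧ γ = (ζ : Gm n n)}
  zero_mem' := ⟨0, Eventually.of_forall fun _ => contDiff_const.contDiffAt, rfl, rfl⟩
  add_mem' := by
    rintro _ _ ⟨a, ha, ha0, rfl⟩ ⟨b, hb, hb0, rfl⟩
    exact ⟨a + b, (ha.and hb).mono fun x h => h.1.add h.2, by simp [ha0, hb0], rfl⟩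
  smul_mem' := by
    rintro r _ ⟨a, ha, ha0, rfl⟩
    exact ⟨r • a, ha.mono fun x h => h.const_smul r, by simp [ha0], rfl⟩

/-- `θ[G]₀(p)`: the germs of smooth vector fields `η` on `(ℝᵖ, 0)` with `η(0) = 0` whose Jacobi
matrix `(∂ηᵢ/∂yⱼ)(y)` lies in `𝔤` at every point `y` near `0`. -/
def thetaG {p : ℕ} (G : Subgroup (GL (Fin p) ℝ)) : Submodule ℝ (Gm p p) where
  carrier := {γ | ∃ η : E p → E p, SmoothNear η ∧ η 0 = 0 ∧
    (∀ᶠ y in 𝓝 (0 : E p), jac η y ∈ lieAlg G) ∧ γ = (η : Gm p p)}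
  zero_mem' := ⟨0, Eventually.of_forall fun _ => contDiff_const.contDiffAt, rfl,
    Eventually.of_forall fun y => by simp [jac], rfl⟩
  add_mem' := by
    rintro _ _ ⟨a, ha, ha0, hag, rfl⟩ ⟨b, hb, hb0, hbg, rfl⟩
    refine ⟨a + b, (ha.and hb).mono fun x h => h.1.add h.2, by simp [ha0, hb0], ?_, rfl⟩
    filter_upwards [ha.diff, hb.diff, hag, hbg] with y h1 h2 h3 h4
    have h : jac (a + b) y = jac a y + jac b y := by simp [jac, fderiv_add h1 h2]
    rw [h]
    exact add_mem h3 h4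
  smul_mem' := by
    rintro r _ ⟨a, ha, ha0, hag, rfl⟩
    refine ⟨r • a, ha.mono fun x h => h.const_smul r, by simp [ha0], ?_, rfl⟩
    filter_upwards [ha.diff, hag] with y h1 h3
    have h : jac (r • a) y = r • jac a y := by simp [jac, fderiv_const_smul h1]
    rw [h]
    exact Submodule.smul_mem _ r h3

/-- `tf(ζ) = df ∘ ζ`, the germ of `x ↦ df_x (ζ(x))`. -/
noncomputable def tMap {n p : ℕ} (f : E n → E p) : Gm n n →ₗ[ℝ] Gm n p where
  toFun ζ := Germ.map₂ (fun (L : E n →L[ℝ] E p) (v : E n) => L v)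
    ((fun x => fderiv ℝ f x : E n → (E n →L[ℝ] E p)) :
      Germ (𝓝 (0 : E n)) (E n →L[ℝ] E p)) ζ
  map_add' := by
    rintro ⟨a⟩ ⟨b⟩
    exact Germ.coe_eq.2 (Eventually.of_forall fun x => map_add (fderiv ℝ f x) (a x) (b x))
  map_smul' := by
    rintro r ⟨a⟩
    exact Germ.coe_eq.2 (Eventually.of_forall fun x => map_smul (fderiv ℝ f x) r (a x))

/-- `ωf(ξ) = ξ ∘ f`. -/
def omegaMap {n p : ℕ} (f : E n → E p) (hf : IsMapGerm f) : Gm p p →ₗ[ℝ] Gm n p where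
  toFun ξ := ξ.compTendsto f hf.tendsto
  map_add' := by rintro ⟨a⟩ ⟨b⟩; rfl
  map_smul' := by rintro r ⟨a⟩; rfl

/-- `X ↦ X · f`, the germ of `x ↦ X f(x)`. -/
def actMap {n p : ℕ} (f : E n → E p) : Matrix (Fin p) (Fin p) ℝ →ₗ[ℝ] Gm n p where
  toFun X := ((fun x => X *ᵥ f x : E n → E p) : Gm n p)
  map_add' X Y := Germ.coe_eq.2 (Eventually.of_forall fun x => Matrix.add_mulVec X Y (f x))
  map_smul' r X := Germ.coe_eq.2 (Eventually.of_forall fun x => Matrix.smul_mulVec r X (f x))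

/-- `T𝒜[G](f) = tf(𝔐_n θ(n)) + ωf(θ[G]₀(p))`. -/
noncomputable def tangentA {n p : ℕ} (G : Subgroup (GL (Fin p) ℝ)) (f : E n → E p)
    (hf : IsMapGerm f) : Submodule ℝ (Gm n p) :=
  (thetaZero n).map (tMap f) ⊔ (thetaG G).map (omegaMap f hf)

/-- `T(ℛ × G)(f) = tf(𝔐_n θ(n)) + 𝔤(f)`, where `𝔤(f) = {X · f | X ∈ 𝔤}`. -/
noncomputable def tangentRG {n p : ℕ} (G : Subgroup (GL (Fin p) ℝ)) (f : E n → E p) :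
    Submodule ℝ (Gm n p) :=
  (thetaZero n).map (tMap f) ⊔ (lieAlg G).map (actMap f)

/-- `𝔤 ≅ θ[G]₀(p)` as real vector spaces. -/
def CondIso {p : ℕ} (G : Subgroup (GL (Fin p) ℝ)) : Prop :=
  Nonempty (lieAlg G ≃ₗ[ℝ] thetaG G)

/-- Every component `ηᵢ` of every `η ∈ θ[G]₀(p)` is (the germ of) a linear function. -/
def CondLinear {p : ℕ} (G : Subgroup (GL (Fin p) ℝ)) : Prop :=
  ∀ η ∈ thetaG G, ∀ i : Fin p, ∃ l : E p →ₗ[ℝ] ℝ,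
    η.map (fun v => v i) = ((fun y => l y : E p → ℝ) : Germ (𝓝 (0 : E p)) ℝ)

/-- `Diff₀[G](p) = G`. -/
def CondDiff {p : ℕ} (G : Subgroup (GL (Fin p) ℝ)) : Prop :=
  DiffZero G = linearGerms G

end GeomEquiv

namespace GeomEquiv

/-! The argument turns on the first prolongation of the Lie algebra 𝔤: the symmetric bilinear maps
`B` with every `B u` in 𝔤. Each of the three conditions forces it to vanish, and its vanishing
yields both conclusions.

Suppose it vanishes. The second derivative of a field in `thetaG G` takes values in it, so the field
is linear (`thetaG_le_of_trivial`) and the tangent spaces agree. For ψ in Diff[G], so does Dψ(y)⁻¹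
D²ψ(y), hence ψ is linear (`isDiffG_linear`). Conversely, every element of `G` is joined to the
identity by a smooth path in `G`, by Cartan's theorem and connectedness (`exists_smooth_path`). So
Diff₀[G] = G and the equivalences agree.

Now let `B` be in the prolongation. The field B(y, y) has Jacobian 2 B(y) in 𝔤, so linearity of all
fields kills `B`; the isomorphism condition reduces to this case by a dimension count. Under
Diff₀[G] = G, flow along y' = B(y, y) instead: the Jacobians solve a linear equation with
coefficients in 𝔤, and a Gronwall estimate (`mem_closure_of_hasDerivWithinAt`) keeps them in `G`.
The flow germs lie in Diff₀[G] for small times, hence are linear, and their quadratic term s B(v, v)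
must vanish. The flow comes from the inverse function theorem on path space, which makes it analytic
in the point and the time jointly. -/

variable {n p : ℕ} {G : Subgroup (GL (Fin p) ℝ)}

/-! ### The group and its Lie algebra as endomorphisms -/

/-- Square matrices as continuous linear endomorphisms of `ℝᵖ`. -/
noncomputable def toL (p : ℕ) : Matrix (Fin p) (Fin p) ℝ ≃ₐ[ℝ] (E p →L[ℝ] E p) :=
  Matrix.toLinAlgEquiv'.trans (Module.End.toContinuousLinearMap (E p))

theorem toL_apply {p : ℕ} (A : Matrix (Fin p) (Fin p) ℝ) (v : E p) : toL p A v = A *ᵥ v := rfl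

theorem toL_jac {p : ℕ} (f : E p → E p) (x : E p) : toL p (jac f x) = fderiv ℝ f x := by
  ext1 v
  simp only [toL_apply, jac, LinearMap.toMatrix'_mulVec]
  rfl

theorem continuous_toL_symm (p : ℕ) :
    @Continuous (E p →L[ℝ] E p) (Matrix (Fin p) (Fin p) ℝ) _ _ (toL p).symm := by
  exact LinearMap.continuous_of_finiteDimensional ((toL p).symm.toLinearMap)

/-- The group `G` as a set of endomorphisms of `ℝᵖ`. -/
def endG {p : ℕ} (G : Subgroup (GL (Fin p) ℝ)) : Set (E p →L[ℝ] E p) :=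
  {L | ∃ A ∈ G, toL p (A : Matrix (Fin p) (Fin p) ℝ) = L}

/-- The Lie algebra of `G` as a space of endomorphisms of `ℝᵖ`. -/
noncomputable def endLie {p : ℕ} (G : Subgroup (GL (Fin p) ℝ)) : Submodule ℝ (E p →L[ℝ] E p) :=
  (lieAlg G).map (toL p).toLinearMap

theorem toL_mem_endLie {X : Matrix (Fin p) (Fin p) ℝ} : toL p X ∈ endLie G ↔ X ∈ lieAlg G := by
  constructor
  · rintro ⟨Y, hY, h⟩
    rwa [← (toL p).injective h]
  · exact fun h => ⟨X, h, rfl⟩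

theorem one_mem_endG : (1 : E p →L[ℝ] E p) ∈ endG G := ⟨1, G.one_mem, by simp⟩

theorem mul_mem_endG {L M : E p →L[ℝ] E p} (hL : L ∈ endG G) (hM : M ∈ endG G) :
    L * M ∈ endG G := by
  obtain ⟨A, hA, rfl⟩ := hL
  obtain ⟨B, hB, rfl⟩ := hM
  exact ⟨A * B, G.mul_mem hA hB, by simp⟩

theorem exists_inv_endG {L : E p →L[ℝ] E p} (hL : L ∈ endG G) :
    ∃ M ∈ endG G, L * M = 1 ∧ M * L = 1 := by
  obtain ⟨A, hA, rfl⟩ := hL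
  refine ⟨_, ⟨A⁻¹, G.inv_mem hA, rfl⟩, ?_, ?_⟩
  · rw [← map_mul, Units.mul_inv, map_one]
  · rw [← map_mul, Units.inv_mul, map_one]

theorem isUnit_of_mem_endG {L : E p →L[ℝ] E p} (hL : L ∈ endG G) : IsUnit L := by
  obtain ⟨M, -, h1, h2⟩ := exists_inv_endG hL
  exact ⟨⟨L, M, h1, h2⟩, rfl⟩

/-- `G` is closed only in the general linear group, so the limit has to be known invertible. The
units carry the topology induced from all endomorphisms, so closure points that are units are
closure points within the units. -/
theorem mem_endG_of_mem_closure (hclosed : IsClosed (G : Set (GL (Fin p) ℝ)))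
    {L : E p →L[ℝ] E p} (hL : L ∈ closure (endG G)) (hu : IsUnit L) : L ∈ endG G := by
  let e : (E p →L[ℝ] E p)ˣ →* GL (Fin p) ℝ := Units.map ((toL p).symm : _ →* _)
  have he : Continuous e := Continuous.units_map _ (continuous_toL_symm p)
  have hcl : IsClosed (e ⁻¹' (G : Set (GL (Fin p) ℝ))) := hclosed.preimage he
  have heq : endG G ⊆ Units.val '' (e ⁻¹' (G : Set (GL (Fin p) ℝ))) := by
    rintro _ ⟨A, hA, rfl⟩
    refine ⟨Units.map ((toL p) : _ →* _) A, ?_, rfl⟩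
    have : e (Units.map ((toL p) : _ →* _) A) = A := by
      ext1
      exact (toL p).symm_apply_apply _
    simpa [this] using hA
  obtain ⟨u, rfl⟩ := hu
  have hu : u ∈ closure (e ⁻¹' (G : Set (GL (Fin p) ℝ))) := by
    rw [Units.isOpenEmbedding_val.isInducing.closure_eq_preimage_closure_image]
    exact closure_mono heq hL
  rw [hcl.closure_eq] at hu
  exact ⟨e u, hu, (toL p).apply_symm_apply _⟩

theorem exists_curve {L : E p →L[ℝ] E p} (hL : L ∈ endLie G) :
    ∃ c : ℝ → E p →L[ℝ] E p, (∀ t, c t ∈ endG G) ∧ c 0 = 1 ∧ HasDerivAt c L 0 := by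
  obtain ⟨X, ⟨c, hc, hc0, -, hcd⟩, rfl⟩ := hL
  refine ⟨fun t => toL p (c t : Matrix (Fin p) (Fin p) ℝ), fun t => ⟨c t, hc t, rfl⟩, ?_, ?_⟩
  · simp [hc0]
  -- Derivatives in `lieAlg` are entrywise; expansion in matrix units turns them into a derivative
  -- in operator norm.
  · have key : ∀ M : Matrix (Fin p) (Fin p) ℝ,
        toL p M = ∑ i, ∑ j, M i j • toL p (Matrix.single i j 1) := by
      intro M
      conv_lhs => rw [Matrix.matrix_eq_sum_single M]
      simp only [map_sum, ← map_smul, Matrix.smul_single, smul_eq_mul, mul_one]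
    have h : HasDerivAt (fun t => ∑ i, ∑ j, (c t : Matrix (Fin p) (Fin p) ℝ) i j •
        toL p (Matrix.single i j 1)) (∑ i, ∑ j, X i j • toL p (Matrix.single i j 1)) 0 :=
      HasDerivAt.fun_sum fun i _ => HasDerivAt.fun_sum fun j _ => by
        have := (hcd i j).smul_const (toL p (Matrix.single i j 1))
        exact this
    rw [← key X] at h
    exact h.congr_of_eventuallyEq (Eventually.of_forall fun t => key _)

theorem mem_endLie_of_curve {c : ℝ → E p →L[ℝ] E p} {L : E p →L[ℝ] E p}
    (hc : ∀ t, c t ∈ endG G) (hc0 : c 0 = 1) (hcs : ContDiff ℝ ∞ c) (hcd : HasDerivAt c L 0) :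
    L ∈ endLie G := by
  choose A hA hAc using hc
  have e : ∀ (M : Matrix (Fin p) (Fin p) ℝ) i j, M i j = toL p M (Pi.single j 1) i := by
    intro M i j
    simp [toL_apply]
  have hcoe : ∀ i j (t : ℝ), (A t : Matrix (Fin p) (Fin p) ℝ) i j = c t (Pi.single j 1) i := by
    intro i j t
    exact (e _ i j).trans (by rw [hAc])
  obtain ⟨X, rfl⟩ := (toL p).surjective L
  rw [toL_mem_endLie]
  refine ⟨A, hA, ?_, fun i j => ?_, fun i j => ?_⟩
  · ext1
    apply (toL p).injective
    simp [hAc, hc0]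
  · simp only [hcoe]
    exact contDiff_pi.1 (hcs.clm_apply contDiff_const) i
  · simp only [hcoe, e X]
    exact hasDerivAt_pi.1 (hcd.clm_apply (hasDerivAt_const _ _)) i |>.congr_deriv (by simp)

/-! ### Invariance of the group under linear equations -/

/-- A curve solving `a' = X a` with `X` in the Lie algebra and starting in `G` stays in the
closure of `G`. -/
theorem mem_closure_of_hasDerivWithinAt {a X : ℝ → E p →L[ℝ] E p} {T K : ℝ}
    (ha : ContinuousOn a (Icc 0 T))
    (ha' : ∀ t ∈ Ico 0 T, HasDerivWithinAt a (X t * a t) (Ioi t) t)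
    (hX : ∀ t ∈ Ico 0 T, X t ∈ endLie G) (hK : ∀ t ∈ Ico 0 T, ‖X t‖ ≤ K)
    (h0 : a 0 ∈ endG G) : ∀ t ∈ Icc 0 T, a t ∈ closure (endG G) := by
  have hne : (endG G).Nonempty := ⟨1, one_mem_endG⟩
  set f : ℝ → ℝ := fun t => Metric.infDist (a t) (endG G) with hf
  have hfc : ContinuousOn f (Icc 0 T) := (Metric.continuous_infDist_pt _).comp_continuousOn ha
  have hf0 : f 0 ≤ 0 := (Metric.infDist_zero_of_mem h0).le
  intro t ht
  -- The distance to `G` starts at zero and its lower right derivative is at most `‖X t‖` times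
  -- itself, so it stays zero.
  have main := le_gronwallBound_of_liminf_deriv_right_le (f := f)
    (f' := fun t => ‖X t‖ * f t) (δ := 0) (K := K) (ε := 0) hfc ?_ hf0 ?_ t ht
  · rw [gronwallBound_ε0_δ0] at main
    rw [Metric.mem_closure_iff_infDist_zero hne]
    exact le_antisymm main Metric.infDist_nonneg
  · intro x hx r hr
    apply Eventually.frequently
    obtain ⟨c, hc, hc0, hcd⟩ := exists_curve (hX x hx)
    have hsub : HasDerivAt (fun z : ℝ => z - x) 1 x := (hasDerivAt_id x).sub_const x
    have hcx : HasDerivAt (fun z => c (z - x)) (X x) x := by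
      have h2 : HasDerivAt c (X x) (x - x) := by simpa using hcd
      have := HasDerivAt.scomp (h := fun z : ℝ => z - x) x h2 hsub
      simpa [Function.comp_def] using this
    have h1 : Tendsto (fun z => ‖(z - x)⁻¹ • (c (z - x) - 1)‖) (𝓝[>] x) (𝓝 ‖X x‖) := by
      have := (hasDerivWithinAt_iff_tendsto_slope' (by simp)).1 (hcx.hasDerivWithinAt (s := Ioi x))
      have := this.norm
      simpa [slope_def_module, hc0] using this
    -- `a` and `c (· - x) * a x` have the same right derivative at `x`, so they differ by o(z - x).
    have h2 : Tendsto (fun z => ‖(z - x)⁻¹ • (a z - c (z - x) * a x)‖) (𝓝[>] x) (𝓝 0) := by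
      have h3 := (ha' x hx).sub ((hcx.hasDerivWithinAt (s := Ioi x)).mul_const (a x))
      have := ((hasDerivWithinAt_iff_tendsto_slope' (by simp)).1 h3).norm
      simpa [slope_def_module, hc0] using this
    have h3 : Tendsto (fun z => ‖(z - x)⁻¹ • (c (z - x) - 1)‖ * f x +
        ‖(z - x)⁻¹ • (a z - c (z - x) * a x)‖) (𝓝[>] x) (𝓝 (‖X x‖ * f x + 0)) :=
      (h1.mul_const _).add h2
    have hr' : ‖X x‖ * f x + 0 < r := by simpa using hr
    filter_upwards [h3.eventually (gt_mem_nhds hr'), self_mem_nhdsWithin] with z hz hzx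
    refine lt_of_le_of_lt ?_ hz
    have hpos : 0 < z - x := sub_pos.2 hzx
    have hinv : ‖(z - x)⁻¹‖ = (z - x)⁻¹ := by
      rw [Real.norm_eq_abs, abs_of_pos (inv_pos.2 hpos)]
    rw [norm_smul, norm_smul, hinv, mul_assoc, ← mul_add]
    refine mul_le_mul_of_nonneg_left ?_ (inv_pos.2 hpos).le
    have hcn : ‖c (z - x)‖ ≤ ‖c (z - x) - 1‖ + 1 := by
      calc ‖c (z - x)‖ = ‖(c (z - x) - 1) + 1‖ := by simp
        _ ≤ ‖c (z - x) - 1‖ + ‖(1 : E p →L[ℝ] E p)‖ := norm_add_le _ _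
        _ ≤ _ := by
          gcongr
          exact ContinuousLinearMap.norm_id_le
    -- Left translation by `c (z - x)` preserves `G`, so it carries near-minimisers for `a x` to
    -- competitors for `a z`.
    have hle : f z ≤ ‖c (z - x)‖ * f x + ‖a z - c (z - x) * a x‖ := by
      refine le_of_forall_pos_lt_add fun ε hε => ?_
      have hd : 0 < ‖c (z - x)‖ + 1 := by positivity
      obtain ⟨B, hB, hBd⟩ := (Metric.infDist_lt_iff hne).1
        (show f x < f x + ε / (‖c (z - x)‖ + 1) by linarith [div_pos hε hd])
      calc f z ≤ dist (a z) (c (z - x) * B) :=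
            Metric.infDist_le_dist_of_mem (mul_mem_endG (hc _) hB)
        _ = ‖(a z - c (z - x) * a x) + c (z - x) * (a x - B)‖ := by
            rw [dist_eq_norm]
            congr 1
            rw [mul_sub]
            abel
        _ ≤ ‖a z - c (z - x) * a x‖ + ‖c (z - x)‖ * ‖a x - B‖ :=
            (norm_add_le _ _).trans (by gcongr; exact norm_mul_le _ _)
        _ ≤ ‖a z - c (z - x) * a x‖ + ‖c (z - x)‖ * (f x + ε / (‖c (z - x)‖ + 1)) := by
            rw [← dist_eq_norm (a x) B]
            gcongr
        _ < _ := by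
            have : ‖c (z - x)‖ * (ε / (‖c (z - x)‖ + 1)) < ε := by
              rw [← mul_div_assoc, div_lt_iff₀ hd]
              nlinarith [norm_nonneg (c (z - x))]
            linarith
    have hfx : 0 ≤ f x := Metric.infDist_nonneg
    nlinarith
  · intro x hx
    have : 0 ≤ f x := Metric.infDist_nonneg
    nlinarith [hK x hx]

/-! ### Exponentials, Cartan's theorem and smooth paths -/

/-- The map (k, m) ↦ exp k · exp m has derivative (k, m) ↦ k + m at the origin, an isomorphism for
complementary subspaces; `g` is its local inverse. -/
theorem exists_local_exp_factorization {𝔸 : Type*} [NormedRing 𝔸] [NormedAlgebra ℝ 𝔸]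
    [FiniteDimensional ℝ 𝔸] {K M : Submodule ℝ 𝔸} (h : IsCompl K M) :
    ∃ g : 𝔸 → K × M, Tendsto g (𝓝 1) (𝓝 0) ∧
      ∀ᶠ a in 𝓝 (1 : 𝔸), NormedSpace.exp ((g a).1 : 𝔸) * NormedSpace.exp ((g a).2 : 𝔸) = a := by
  have : CompleteSpace 𝔸 := FiniteDimensional.complete ℝ 𝔸
  let e : (K × M) ≃L[ℝ] 𝔸 := (Submodule.prodEquivOfIsCompl K M h).toContinuousLinearEquiv
  let F : K × M → 𝔸 := fun z => NormedSpace.exp (z.1 : 𝔸) * NormedSpace.exp (z.2 : 𝔸)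
  have hF : HasStrictFDerivAt F (e : (K × M) →L[ℝ] 𝔸) 0 := by
    have hexp : HasStrictFDerivAt (NormedSpace.exp : 𝔸 → 𝔸) (1 : 𝔸 →L[ℝ] 𝔸) 0 :=
      hasStrictFDerivAt_exp_zero
    have h1 : HasStrictFDerivAt (fun z : K × M => NormedSpace.exp (z.1 : 𝔸)) _ 0 :=
      HasStrictFDerivAt.comp (g := NormedSpace.exp) (0 : K × M) hexp
        (K.subtypeL.comp (ContinuousLinearMap.fst ℝ K M)).hasStrictFDerivAt
    have h2 : HasStrictFDerivAt (fun z : K × M => NormedSpace.exp (z.2 : 𝔸)) _ 0 :=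
      HasStrictFDerivAt.comp (g := NormedSpace.exp) (0 : K × M) hexp
        (M.subtypeL.comp (ContinuousLinearMap.snd ℝ K M)).hasStrictFDerivAt
    refine (h1.mul' h2).congr_fderiv ?_
    refine ContinuousLinearMap.ext fun z => ?_
    simp [e, add_comm]
  have hF0 : F 0 = 1 := by simp [F]
  refine ⟨hF.localInverse F e 0, ?_, ?_⟩
  · simpa [hF0] using hF.localInverse_tendsto
  · simpa [hF0] using hF.eventually_right_inverse

theorem exp_add_smul (s t : ℝ) (X : E p →L[ℝ] E p) :
    NormedSpace.exp ((s + t) • X) = NormedSpace.exp (s • X) * NormedSpace.exp (t • X) := by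
  let _ : NormedAlgebra ℚ (E p →L[ℝ] E p) := NormedAlgebra.restrictScalars ℚ ℝ _
  rw [add_smul]
  exact NormedSpace.exp_add_of_commute (((Commute.refl X).smul_left s).smul_right t)

theorem exp_neg_mul_exp (X : E p →L[ℝ] E p) :
    NormedSpace.exp (-X) * NormedSpace.exp X = 1 := by
  have h := exp_add_smul (-1) 1 X
  rw [neg_one_smul ℝ X, one_smul ℝ X, neg_add_cancel, zero_smul, NormedSpace.exp_zero] at h
  exact h.symm

theorem exp_mul_exp_neg (X : E p →L[ℝ] E p) :
    NormedSpace.exp X * NormedSpace.exp (-X) = 1 := by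
  simpa using exp_neg_mul_exp (-X)

theorem isUnit_exp_end (X : E p →L[ℝ] E p) : IsUnit (NormedSpace.exp X) :=
  ⟨⟨_, _, exp_mul_exp_neg X, exp_neg_mul_exp X⟩, rfl⟩

theorem contDiff_exp_smul (X : E p →L[ℝ] E p) :
    ContDiff ℝ ∞ fun t : ℝ => NormedSpace.exp (t • X) := by
  have h : ContDiff ℝ ∞ (NormedSpace.exp : (E p →L[ℝ] E p) → E p →L[ℝ] E p) :=
    contDiff_iff_contDiffAt.2 fun x => (NormedSpace.exp_analytic (𝕂 := ℝ) x).contDiffAt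
  exact h.comp (contDiff_id.smul contDiff_const)

theorem exp_neg_mem_endG {X : E p →L[ℝ] E p} (h : NormedSpace.exp X ∈ endG G) :
    NormedSpace.exp (-X) ∈ endG G := by
  obtain ⟨M, hM, h1, -⟩ := exists_inv_endG h
  rwa [left_inv_eq_right_inv (exp_neg_mul_exp X) h1]

theorem exp_int_smul_mem_endG {X : E p →L[ℝ] E p} (h : NormedSpace.exp X ∈ endG G) (k : ℤ) :
    NormedSpace.exp ((k : ℝ) • X) ∈ endG G := by
  have hn : ∀ k : ℕ, NormedSpace.exp ((k : ℝ) • X) ∈ endG G := by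
    intro k
    induction k with
    | zero => simpa using one_mem_endG
    | succ k ih =>
      rw [Nat.cast_succ, exp_add_smul, one_smul]
      exact mul_mem_endG ih h
  obtain ⟨n, rfl | rfl⟩ := k.eq_nat_or_neg
  · simpa using hn n
  · have h := exp_neg_mem_endG (hn n)
    rw [← neg_smul (n : ℝ) X] at h
    rw [Int.cast_neg, Int.cast_natCast]
    exact h

theorem exp_mem_endG (hclosed : IsClosed (G : Set (GL (Fin p) ℝ))) {X : E p →L[ℝ] E p}
    (hX : X ∈ endLie G) : NormedSpace.exp X ∈ endG G := by
  have h := mem_closure_of_hasDerivWithinAt (G := G) (a := fun t : ℝ => NormedSpace.exp (t • X))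
    (X := fun _ => X) (T := 1) (K := ‖X‖) (contDiff_exp_smul X).continuous.continuousOn
    (fun t _ => (hasDerivAt_exp_smul_const' X t).hasDerivWithinAt) (fun _ _ => hX)
    (fun _ _ => le_rfl) (by simpa using one_mem_endG) 1 (by simp)
  simp only [one_smul] at h
  exact mem_endG_of_mem_closure hclosed h (isUnit_exp_end X)

theorem mem_endLie_of_exp {X : E p →L[ℝ] E p}
    (hX : ∀ t : ℝ, NormedSpace.exp (t • X) ∈ endG G) : X ∈ endLie G :=
  mem_endLie_of_curve hX (by simp) (contDiff_exp_smul X)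
    ((hasDerivAt_exp_smul_const X (0 : ℝ)).congr_deriv (by simp))

/-- Cartan's closed subgroup theorem: the exponentials of the Lie algebra fill a neighbourhood
of the identity in `G`. -/
theorem eventually_mem_exp_image (hclosed : IsClosed (G : Set (GL (Fin p) ℝ))) :
    ∀ᶠ L in 𝓝[endG G] (1 : E p →L[ℝ] E p), L ∈ NormedSpace.exp '' (endLie G : Set _) := by
  by_contra hcon
  obtain ⟨L, hL, hLn⟩ := exists_seq_forall_of_frequently (not_eventually.1 hcon)
  obtain ⟨hL1, hLG⟩ := tendsto_nhdsWithin_iff.1 hL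
  obtain ⟨M, hM⟩ := (endLie G).exists_isCompl
  obtain ⟨g, hg, hFg'⟩ := exists_local_exp_factorization hM
  have hgt : Tendsto (fun n => g (L n)) atTop (𝓝 0) := hg.comp hL1
  have hFg := hL1.eventually hFg'
  let Y : ℕ → E p →L[ℝ] E p := fun n => ((g (L n)).2 : E p →L[ℝ] E p)
  have hYt : Tendsto Y atTop (𝓝 0) :=
    ((M.subtypeL.comp (ContinuousLinearMap.snd ℝ (endLie G) M)).continuous.tendsto' 0 0
      (by simp)).comp hgt
  have hYM : ∀ n, Y n ∈ M := fun n => (g (L n)).2.2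
  -- Cancelling the factor from `endLie G`, whose exponential is in `G`, leaves the transverse
  -- factor in `G`.
  have hYG : ∀ᶠ n in atTop, NormedSpace.exp (Y n) ∈ endG G := by
    filter_upwards [hFg, hLG] with n hn hGn
    have h1 := exp_neg_mem_endG (exp_mem_endG hclosed (g (L n)).1.2)
    have h2 : NormedSpace.exp (-((g (L n)).1 : E p →L[ℝ] E p)) * L n = NormedSpace.exp (Y n) := by
      nth_rw 2 [← hn]
      rw [← mul_assoc, exp_neg_mul_exp, one_mul]
    rw [← h2]
    exact mul_mem_endG h1 hGn
  have hY0 : ∀ᶠ n in atTop, Y n ≠ 0 := by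
    filter_upwards [hFg] with n hn h0
    refine hLn n ⟨(g (L n)).1, (g (L n)).1.2, ?_⟩
    rwa [show ((g (L n)).2 : E p →L[ℝ] E p) = 0 from h0, NormedSpace.exp_zero, mul_one] at hn
  obtain ⟨N, hN⟩ := eventually_atTop.1 (hYG.and hY0)
  -- `Z` is a limit direction of the transverse parts. Its one-parameter group will lie in `G`,
  -- which puts `Z` in both `endLie G` and `M`, against norm one.
  obtain ⟨Z, hZ, φ, hφ, hlim⟩ := (isCompact_sphere (0 : E p →L[ℝ] E p) 1).tendsto_subseq
    (x := fun n => ‖Y (n + N)‖⁻¹ • Y (n + N)) fun n => by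
      simp [norm_smul, norm_ne_zero_iff.2 (hN (n + N) (by simp)).2]
  have hZM : Z ∈ M := M.closed_of_finiteDimensional.mem_of_tendsto hlim
    (Eventually.of_forall fun n => M.smul_mem _ (hYM _))
  have hidx : Tendsto (fun n => φ n + N) atTop atTop :=
    (tendsto_add_atTop_nat N).comp hφ.tendsto_atTop
  have hnorm : Tendsto (fun n => ‖Y (φ n + N)‖) atTop (𝓝 0) := by
    simpa using (hYt.comp hidx).norm
  have hZG : ∀ t : ℝ, NormedSpace.exp (t • Z) ∈ endG G := by
    intro t
    refine mem_endG_of_mem_closure hclosed ?_ (isUnit_exp_end _)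
    -- Since the norms of the `Y` tend to zero, integer multiples of them reach every t • Z in the
    -- limit, and exponentials of integer multiples stay in `G`.
    have hfl : Tendsto (fun n => (⌊t / ‖Y (φ n + N)‖⌋ : ℝ) * ‖Y (φ n + N)‖) atTop (𝓝 t) := by
      rw [tendsto_iff_norm_sub_tendsto_zero]
      refine squeeze_zero (fun _ => norm_nonneg _) (fun n => ?_) hnorm
      have hpos : 0 < ‖Y (φ n + N)‖ := norm_pos_iff.2 (hN _ (by simp)).2
      have h1 := Int.floor_le (t / ‖Y (φ n + N)‖)
      have h2 := Int.lt_floor_add_one (t / ‖Y (φ n + N)‖)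
      rw [le_div_iff₀ hpos] at h1
      rw [div_lt_iff₀ hpos] at h2
      rw [Real.norm_eq_abs, abs_le]
      constructor <;> linarith
    have hsm : Tendsto (fun n => (⌊t / ‖Y (φ n + N)‖⌋ : ℝ) • Y (φ n + N)) atTop (𝓝 (t • Z)) := by
      refine (hfl.smul hlim).congr fun n => ?_
      have hpos : ‖Y (φ n + N)‖ ≠ 0 := norm_ne_zero_iff.2 (hN _ (by simp)).2
      simp only [Function.comp_apply, smul_smul]
      rw [mul_assoc, mul_inv_cancel₀ hpos, mul_one]
    have hcont : Continuous (NormedSpace.exp : (E p →L[ℝ] E p) → E p →L[ℝ] E p) :=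
      continuous_iff_continuousAt.2 fun x =>
        (NormedSpace.exp_analytic (𝕂 := ℝ) x).continuousAt
    exact mem_closure_of_tendsto ((hcont.tendsto _).comp hsm)
      (Eventually.of_forall fun n => exp_int_smul_mem_endG (hN _ (by simp)).1 _)
  have hZ0 : Z ∈ endLie G ⊓ M := ⟨mem_endLie_of_exp hZG, hZM⟩
  rw [hM.inf_eq_bot, Submodule.mem_bot] at hZ0
  simp [hZ0] at hZ

/-- In a connected closed linear group every element is joined to the identity by a smooth
curve. -/
theorem exists_smooth_path (hclosed : IsClosed (G : Set (GL (Fin p) ℝ)))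
    (hconn : IsConnected (G : Set (GL (Fin p) ℝ))) {L : E p →L[ℝ] E p} (hL : L ∈ endG G) :
    ∃ c : ℝ → E p →L[ℝ] E p, (∀ t, c t ∈ endG G) ∧ ContDiff ℝ ∞ c ∧ c 0 = 1 ∧ c 1 = L := by
  let H : Subgroup (GL (Fin p) ℝ) :=
    { carrier := {A | ∃ c : ℝ → E p →L[ℝ] E p, (∀ t, c t ∈ endG G) ∧ ContDiff ℝ ∞ c ∧
        c 0 = 1 ∧ c 1 = toL p (A : Matrix (Fin p) (Fin p) ℝ)}
      one_mem' := ⟨fun _ => 1, fun _ => one_mem_endG, contDiff_const, rfl, by simp⟩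
      mul_mem' := by
        rintro A B ⟨c, hc, hcs, hc0, hc1⟩ ⟨d, hd, hds, hd0, hd1⟩
        exact ⟨fun t => c t * d t, fun t => mul_mem_endG (hc t) (hd t), hcs.mul hds,
          by simp [hc0, hd0], by simp [hc1, hd1]⟩
      inv_mem' := by
        rintro A ⟨c, hc, hcs, hc0, hc1⟩
        have h1 : c 1 * toL p ((A⁻¹ : GL (Fin p) ℝ) : Matrix (Fin p) (Fin p) ℝ) = 1 := by
          rw [hc1, ← map_mul, Units.mul_inv, map_one]
        obtain ⟨M, hM, -, h2⟩ := exists_inv_endG (hc 1)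
        have h3 := left_inv_eq_right_inv h2 h1
        -- The reversed path, translated by the inverse of its endpoint so that it starts at the
        -- identity.
        refine ⟨fun t => c (1 - t) * M, fun t => mul_mem_endG (hc _) hM,
          (hcs.comp (contDiff_const.sub contDiff_id)).mul contDiff_const, ?_, ?_⟩
        · simp only [sub_zero, h3, h1]
        · simp [h3, hc0] }
  have : ConnectedSpace G := isConnected_iff_connectedSpace.1 hconn
  have hmem : ((H.subgroupOf G : Subgroup G) : Set G) ∈ 𝓝 (1 : G) := by
    have hcont : Tendsto (fun A : G => toL p ((A : GL (Fin p) ℝ) : Matrix (Fin p) (Fin p) ℝ))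
        (𝓝 1) (𝓝[endG G] 1) := by
      refine tendsto_nhdsWithin_iff.2 ⟨?_, Eventually.of_forall fun A => ⟨A, A.2, rfl⟩⟩
      have h : Continuous (toL p) :=
        LinearMap.continuous_of_finiteDimensional ((toL p).toLinearMap)
      exact ((h.comp Units.continuous_val).comp continuous_subtype_val).tendsto' _ _ (by simp)
    filter_upwards [hcont.eventually (eventually_mem_exp_image hclosed)] with A hA
    obtain ⟨X, hX, hXA⟩ := hA
    exact ⟨fun t => NormedSpace.exp (t • X),
      fun t => exp_mem_endG hclosed ((endLie G).smul_mem t hX), contDiff_exp_smul X,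
      by simp, by simpa using hXA⟩
  -- An open subgroup is also closed, hence all of the connected group.
  have hopen := Subgroup.isOpen_of_mem_nhds _ hmem
  have huniv := IsClopen.eq_univ ⟨Subgroup.isClosed_of_isOpen _ hopen, hopen⟩ ⟨1, one_mem _⟩
  obtain ⟨A, hA, rfl⟩ := hL
  have : (⟨A, hA⟩ : G) ∈ ((H.subgroupOf G : Subgroup G) : Set G) := by
    rw [huniv]
    trivial
  exact this

/-! ### Trivial prolongation and linearity -/

/-- The first prolongation of the Lie algebra of `G`, i.e. the space of symmetric bilinear maps
all of whose partial applications lie in the Lie algebra, is trivial. -/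
def HasTrivialProlongation (G : Subgroup (GL (Fin p) ℝ)) : Prop :=
  ∀ B : E p →L[ℝ] E p →L[ℝ] E p, (∀ u v, B u v = B v u) → (∀ u, B u ∈ endLie G) → B = 0

theorem eq_zero_of_diagonal {B : E p →L[ℝ] E p →L[ℝ] E p} (hs : ∀ u v, B u v = B v u)
    (h : ∀ v, B v v = 0) : B = 0 := by
  ext1 u
  ext1 v
  have h1 := h (u + v)
  simp only [map_add, add_apply, h, hs v u, zero_add, add_zero] at h1
  exact self_eq_neg.1 (eq_neg_of_add_eq_zero_left h1)

theorem hasFDerivAt_quadratic {B : E p →L[ℝ] E p →L[ℝ] E p} (hs : ∀ u v, B u v = B v u)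
    (y : E p) : HasFDerivAt (fun y => B y y) ((2 : ℝ) • B y) y := by
  have h := B.hasFDerivAt (x := y) |>.clm_apply (hasFDerivAt_id y)
  refine h.congr_fderiv ?_
  ext1 v
  simp [two_smul, hs v y]

theorem eventually_eq_fderiv_zero {f : E p → E p} (hf : IsMapGerm f)
    (h2 : ∀ᶠ y in 𝓝 (0 : E p), fderiv ℝ (fderiv ℝ f) y = 0) :
    ∀ᶠ y in 𝓝 (0 : E p), f y = fderiv ℝ f 0 y := by
  obtain ⟨ε, hε, hball⟩ := Metric.eventually_nhds_iff_ball.1 (hf.1.and h2)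
  have hc : IsPreconnected (Metric.ball (0 : E p) ε) := (convex_ball _ _).isPreconnected
  have h0 : (0 : E p) ∈ Metric.ball (0 : E p) ε := Metric.mem_ball_self hε
  have hd1 : ∀ y ∈ Metric.ball (0 : E p) ε, fderiv ℝ f y = fderiv ℝ f 0 := fun y hy =>
    Metric.isOpen_ball.is_const_of_fderiv_eq_zero (𝕜 := ℝ) hc
      (fun z hz => (((hball z hz).1.fderiv_right (m := 1) (by norm_cast)).differentiableAt
        (by simp)).differentiableWithinAt)
      (fun z hz => (hball z hz).2) hy h0
  have hd : ∀ y ∈ Metric.ball (0 : E p) ε,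
      HasFDerivAt (fun y => f y - fderiv ℝ f 0 y) 0 y := fun y hy => by
    have h := ((hball y hy).1.differentiableAt (by simp)).hasFDerivAt.sub
      (fderiv ℝ f 0).hasFDerivAt
    rwa [hd1 y hy, sub_self] at h
  filter_upwards [Metric.ball_mem_nhds (0 : E p) hε] with y hy
  have h := Metric.isOpen_ball.is_const_of_fderiv_eq_zero (𝕜 := ℝ) hc
    (fun z hz => (hd z hz).differentiableAt.differentiableWithinAt)
    (fun z hz => (hd z hz).fderiv) hy h0
  simpa [hf.2, sub_eq_zero] using h

theorem actMap_id_injective : Function.Injective (actMap (fun y : E p => y)) := by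
  intro X Y h
  apply (toL p).injective
  have h' : (fun y : E p => toL p X y) =ᶠ[𝓝 0] fun y => toL p Y y := Germ.coe_eq.1 h
  have h1 := ((toL p X).hasFDerivAt (x := 0)).congr_of_eventuallyEq h'.symm
  exact h1.unique (toL p Y).hasFDerivAt

theorem map_actMap_id_le : (lieAlg G).map (actMap fun y : E p => y) ≤ thetaG G := by
  rintro _ ⟨X, hX, rfl⟩
  refine ⟨fun y => X *ᵥ y, Eventually.of_forall fun y => (toL p X).contDiff.contDiffAt,
    Matrix.mulVec_zero X, Eventually.of_forall fun y => ?_, rfl⟩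
  rw [← toL_mem_endLie, toL_jac]
  have : fderiv ℝ (fun y => X *ᵥ y) y = toL p X := (toL p X).hasFDerivAt.fderiv
  rw [this]
  exact toL_mem_endLie.2 hX

/-- Linear fields embed 𝔤 in `thetaG G`. An abstract isomorphism makes both finite-dimensional of
equal dimension, so the embedding is onto. -/
theorem thetaG_eq_of_condIso (h : CondIso G) :
    thetaG G = (lieAlg G).map (actMap fun y : E p => y) := by
  obtain ⟨e⟩ := h
  have : Module.Finite ℝ (thetaG G) := Module.Finite.equiv e
  refine (Submodule.eq_of_le_of_finrank_eq map_actMap_id_le ?_).symm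
  rw [← e.finrank_eq]
  exact (Submodule.equivMapOfInjective _ actMap_id_injective (lieAlg G)).finrank_eq.symm

theorem condLinear_of_thetaG_eq (h : thetaG G = (lieAlg G).map (actMap fun y : E p => y)) :
    CondLinear G := by
  intro η hη i
  rw [h] at hη
  obtain ⟨X, -, rfl⟩ := hη
  exact ⟨(LinearMap.proj i).comp (Matrix.toLin' X), rfl⟩

theorem fderiv_fderiv_symm {f : E p → E p} {y : E p} (hf : ContDiffAt ℝ ∞ f y) (u v : E p) :
    fderiv ℝ (fderiv ℝ f) y u v = fderiv ℝ (fderiv ℝ f) y v u :=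
  hf.isSymmSndFDerivAt (by simp; norm_cast) u v

theorem hasDerivAt_fderiv_line {f : E p → E p} {y : E p} (hf : ContDiffAt ℝ ∞ f y) (u : E p) :
    HasDerivAt (fun s : ℝ => fderiv ℝ f (y + s • u)) (fderiv ℝ (fderiv ℝ f) y u) 0 := by
  have h1 : HasFDerivAt (fderiv ℝ f) (fderiv ℝ (fderiv ℝ f) y) (y + (0 : ℝ) • u) := by
    rw [zero_smul, add_zero]
    exact ((hf.fderiv_right (m := 1) (by norm_cast)).differentiableAt (by simp)).hasFDerivAt
  have h2 : HasDerivAt (fun s : ℝ => y + s • u) u 0 := by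
    simpa using ((hasDerivAt_id (0 : ℝ)).smul_const u).const_add y
  exact h1.comp_hasDerivAt (f := fun s : ℝ => y + s • u) 0 h2

/-- Difference quotients of the 𝔤-valued Jacobian stay in 𝔤, a closed subspace, so the second
derivative lies in the prolongation. -/
theorem thetaG_le_of_trivial (h : HasTrivialProlongation G) :
    thetaG G ≤ (lieAlg G).map (actMap fun y : E p => y) := by
  rintro _ ⟨η, hs, h0, hj, rfl⟩
  have hL : ∀ᶠ y in 𝓝 (0 : E p), fderiv ℝ η y ∈ endLie G :=
    hj.mono fun y hy => by rwa [← toL_jac, toL_mem_endLie]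
  have h2 : ∀ᶠ y in 𝓝 (0 : E p), fderiv ℝ (fderiv ℝ η) y = 0 := by
    filter_upwards [hs, hL.eventually_nhds] with y hy hyL
    refine h _ (fderiv_fderiv_symm hy) fun u => ?_
    have hline : Tendsto (fun s : ℝ => y + s • u) (𝓝[≠] 0) (𝓝 y) := by
      have : Continuous fun s : ℝ => y + s • u := by fun_prop
      exact (this.tendsto' 0 y (by simp)).mono_left nhdsWithin_le_nhds
    refine (endLie G).closed_of_finiteDimensional.mem_of_tendsto
      (hasDerivAt_iff_tendsto_slope.1 (hasDerivAt_fderiv_line hy u)) ?_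
    filter_upwards [hline.eventually hyL] with s hsL
    refine (endLie G).smul_mem _ ((endLie G).sub_mem hsL ?_)
    simpa using hyL.self_of_nhds
  refine ⟨jac η 0, hj.self_of_nhds, Germ.coe_eq.2 ?_⟩
  filter_upwards [eventually_eq_fderiv_zero ⟨hs, h0⟩ h2] with y hy
  rw [hy, ← toL_jac]
  rfl

theorem tangentA_eq_tangentRG (h : thetaG G = (lieAlg G).map (actMap fun y : E p => y))
    (f : E n → E p) (hf : IsMapGerm f) : tangentA G f hf = tangentRG G f := by
  rw [tangentA, tangentRG, h, ← Submodule.map_comp]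
  rfl

/-- The quadratic field B(y, y) belongs to `thetaG G`, and a quadratic form that is linear near the
origin is zero. -/
theorem hasTrivialProlongation_of_condLinear (h : CondLinear G) : HasTrivialProlongation G := by
  intro B hs hB
  refine eq_zero_of_diagonal hs fun v => ?_
  have hmem : ((fun y => B y y : E p → E p) : Gm p p) ∈ thetaG G := by
    refine ⟨fun y => B y y, Eventually.of_forall fun y => ?_, by simp,
      Eventually.of_forall fun y => ?_, rfl⟩
    · exact (B.contDiff.clm_apply contDiff_id).contDiffAt
    · rw [← toL_mem_endLie, toL_jac, (hasFDerivAt_quadratic hs y).fderiv]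
      exact (endLie G).smul_mem _ (hB y)
  ext1 i
  obtain ⟨l, hl⟩ := h _ hmem i
  have hl' : ∀ᶠ y in 𝓝 (0 : E p), B y y i = l y := Germ.coe_eq.1 hl
  have hline : Tendsto (fun s : ℝ => s • v) (𝓝 0) (𝓝 0) := by
    have : Continuous fun s : ℝ => s • v := by fun_prop
    exact this.tendsto' 0 0 (by simp)
  -- Two scales on the ray through `v` separate the quadratic term from the linear one.
  obtain ⟨ε, hε, hball⟩ := Metric.eventually_nhds_iff.1 (hline.eventually hl')
  have h1 := @hball (ε / 2) (by rw [dist_zero_right, Real.norm_eq_abs, abs_of_pos] <;> linarith)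
  have h2 := @hball (ε / 4) (by rw [dist_zero_right, Real.norm_eq_abs, abs_of_pos] <;> linarith)
  simp only [map_smul, smul_apply, Pi.smul_apply, smul_eq_mul] at h1 h2
  have h3 : ε * ε * B v v i = 0 := by linarith
  simpa [hε.ne'] using h3

/-- If the first prolongation is trivial, every element of `Diff[G](p)` is linear. -/
theorem isDiffG_linear (h : HasTrivialProlongation G) {ψ : E p → E p} (hψ : IsDiffG G ψ) :
    ∃ A ∈ G, ∀ᶠ y in 𝓝 (0 : E p), ψ y = (A : Matrix (Fin p) (Fin p) ℝ) *ᵥ y := by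
  obtain ⟨⟨⟨hs, h0⟩, -⟩, hj⟩ := hψ
  have hL : ∀ᶠ y in 𝓝 (0 : E p), fderiv ℝ ψ y ∈ endG G := by
    filter_upwards [hj] with y hy
    obtain ⟨A, hA, hAy⟩ := hy
    exact ⟨A, hA, by rw [hAy, toL_jac]⟩
  have h2 : ∀ᶠ y in 𝓝 (0 : E p), fderiv ℝ (fderiv ℝ ψ) y = 0 := by
    filter_upwards [hs.eventually_nhds, hL.eventually_nhds] with y hy hyL
    obtain ⟨M, hM, h1, h2⟩ := exists_inv_endG hyL.self_of_nhds
    -- Composing with the inverse `M` of the Jacobian at `y` moves the Jacobian curve through the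
    -- identity, so its velocity lies in the Lie algebra.
    let B : E p →L[ℝ] E p →L[ℝ] E p :=
      (ContinuousLinearMap.compL ℝ (E p) (E p) (E p) M).comp (fderiv ℝ (fderiv ℝ ψ) y)
    have hB : B = 0 := by
      refine h B (fun u v => ?_) fun u => ?_
      · exact congrArg M (fderiv_fderiv_symm hy.self_of_nhds u v)
      · obtain ⟨ε, hε, hball⟩ := Metric.eventually_nhds_iff.1 (hyL.and hy)
        -- A curve in the Lie algebra's definition must stay in `G` for all real times. The bounded
        -- reparametrisation δ sin(s/δ) has unit speed at 0, and this δ keeps the segment in the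
        -- ball.
        let δ : ℝ := ε / (‖u‖ + 1)
        have hδ : 0 < δ := by positivity
        let τ : ℝ → ℝ := fun s => δ * Real.sin (s / δ)
        have hτ : ContDiff ℝ ∞ τ :=
          contDiff_const.mul (Real.contDiff_sin.comp (contDiff_id.div_const δ))
        have hτ0 : τ 0 = 0 := by simp [τ]
        have hτd : HasDerivAt τ 1 0 := by
          have := (((hasDerivAt_id (0 : ℝ)).div_const δ).sin).const_mul δ
          simpa [hδ.ne'] using this
        have hmem : ∀ s, dist (y + τ s • u) y < ε := by
          intro s
          rw [dist_self_add_left, norm_smul, Real.norm_eq_abs, abs_mul, abs_of_pos hδ]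
          calc δ * |Real.sin (s / δ)| * ‖u‖ ≤ δ * 1 * ‖u‖ := by
                gcongr
                exact Real.abs_sin_le_one _
            _ < δ * (‖u‖ + 1) := by nlinarith
            _ = ε := by
                simp only [δ]
                field_simp
        refine mem_endLie_of_curve (c := fun s => M * fderiv ℝ ψ (y + τ s • u))
          (fun s => mul_mem_endG hM (hball (hmem s)).1) (by simp [hτ0, h2]) ?_ ?_
        · refine contDiff_const.mul (contDiff_iff_contDiffAt.2 fun s => ?_)
          exact ((hball (hmem s)).2.fderiv_right (m := ∞) (by simp)).comp s
            (contDiff_const.add (hτ.smul contDiff_const)).contDiffAt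
        · have h3 := hasDerivAt_fderiv_line hy.self_of_nhds u
          rw [← hτ0] at h3
          have h4 := HasDerivAt.scomp (h := τ) 0 h3 hτd
          rw [one_smul] at h4
          exact h4.const_mul M
    ext1 u
    have h5 : M * fderiv ℝ (fderiv ℝ ψ) y u = 0 := by
      change B u = 0
      rw [hB]
      rfl
    calc fderiv ℝ (fderiv ℝ ψ) y u
        = (fderiv ℝ ψ y * M) * fderiv ℝ (fderiv ℝ ψ) y u := by rw [h1, one_mul]
      _ = 0 := by rw [mul_assoc, h5, mul_zero]
  obtain ⟨A, hA, hA0⟩ := hL.self_of_nhds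
  refine ⟨A, hA, ?_⟩
  filter_upwards [eventually_eq_fderiv_zero ⟨hs, h0⟩ h2] with y hy
  rw [hy, ← hA0]
  rfl

/-! ### Linear germs in Diff₀[G] -/

/-- The inverse function theorem for germs of analytic maps. -/
theorem isDiffeoGerm_of_isUnit_fderiv {f : E p → E p} (hf : ContDiffAt ℝ ω f 0) (h0 : f 0 = 0)
    (hu : IsUnit (fderiv ℝ f 0)) : IsDiffeoGerm f := by
  obtain ⟨u, hu⟩ := hu
  let e : E p ≃L[ℝ] E p := ContinuousLinearEquiv.unitsEquiv ℝ (E p) u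
  have he : (e : E p →L[ℝ] E p) = fderiv ℝ f 0 := by
    rw [← hu]
    rfl
  have hω : (ω : WithTop ℕ∞) ≠ 0 := by simp
  have hd : HasFDerivAt f (e : E p →L[ℝ] E p) 0 := by
    rw [he]
    exact (hf.differentiableAt hω).hasFDerivAt
  have hstrict := hf.hasStrictFDerivAt' hd hω
  -- Analyticity at a point spreads to a neighbourhood, unlike `ContDiffAt ℝ ∞` at a point.
  have hsm : ∀ {g : E p → E p}, ContDiffAt ℝ ω g 0 → SmoothNear g := fun hg =>
    (hg.eventually (by simp)).mono fun x hx => hx.of_le le_top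
  have hinv := hf.to_localInverse hd hω
  have hinv0 := hf.localInverse_apply_image hd hω
  have hright := hstrict.eventually_right_inverse
  rw [h0] at hinv hinv0 hright
  exact ⟨⟨hsm hf, h0⟩, hf.localInverse hd hω, ⟨hsm hinv, hinv0⟩,
    hstrict.eventually_left_inverse, hright⟩

theorem isDiffG_of_analytic {f : E p → E p} (hf : ContDiffAt ℝ ω f 0) (h0 : f 0 = 0)
    (hG : ∀ᶠ y in 𝓝 (0 : E p), fderiv ℝ f y ∈ endG G) : IsDiffG G f := by
  refine ⟨isDiffeoGerm_of_isUnit_fderiv hf h0 (isUnit_of_mem_endG hG.self_of_nhds), ?_⟩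
  filter_upwards [hG] with y hy
  obtain ⟨A, hA, hAy⟩ := hy
  exact ⟨A, hA, (toL p).injective (by rw [hAy, toL_jac])⟩

theorem isDiffG_clm {L : E p →L[ℝ] E p} (hL : L ∈ endG G) : IsDiffG G L :=
  isDiffG_of_analytic L.contDiff.contDiffAt (map_zero L)
    (Eventually.of_forall fun y => by rwa [L.fderiv])

/-- Connectedness is needed here: a smooth path in `G` from the identity to `A` serves as the
isotopy. -/
theorem isDiffZeroG_linear (hclosed : IsClosed (G : Set (GL (Fin p) ℝ)))
    (hconn : IsConnected (G : Set (GL (Fin p) ℝ))) {A : GL (Fin p) ℝ} (hA : A ∈ G) :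
    IsDiffZeroG G fun y => (A : Matrix (Fin p) (Fin p) ℝ) *ᵥ y := by
  have hAG : toL p (A : Matrix (Fin p) (Fin p) ℝ) ∈ endG G := ⟨A, hA, rfl⟩
  obtain ⟨c, hc, hcs, hc0, hc1⟩ := exists_smooth_path hclosed hconn hAG
  refine ⟨isDiffG_clm hAG, fun z => c z.2 z.1, ?_, fun t _ => isDiffG_clm (hc t), ?_, ?_⟩
  · exact Eventually.of_forall fun z =>
      ((hcs.comp contDiff_snd).clm_apply contDiff_fst).contDiffAt
  · exact Eventually.of_forall fun y => by simp [hc0]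
  · exact Eventually.of_forall fun y => by simp only [hc1]; rfl

theorem diffZero_eq_linearGerms (hclosed : IsClosed (G : Set (GL (Fin p) ℝ)))
    (hconn : IsConnected (G : Set (GL (Fin p) ℝ))) (h : HasTrivialProlongation G) :
    CondDiff G := by
  refine Subset.antisymm ?_ ?_
  · rintro _ ⟨ψ, hψ, rfl⟩
    obtain ⟨A, hA, hAψ⟩ := isDiffG_linear h hψ.1
    exact ⟨A, hA, Germ.coe_eq.2 hAψ⟩
  · rintro _ ⟨A, hA, rfl⟩
    exact ⟨_, isDiffZeroG_linear hclosed hconn hA, rfl⟩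

theorem IsDiffZeroG.linear_of_condDiff (h : CondDiff G) {ψ : E p → E p} (hψ : IsDiffZeroG G ψ) :
    ∃ A ∈ G, ∀ᶠ y in 𝓝 (0 : E p), ψ y = (A : Matrix (Fin p) (Fin p) ℝ) *ᵥ y := by
  have hmem : (ψ : Gm p p) ∈ DiffZero G := ⟨ψ, hψ, rfl⟩
  rw [show DiffZero G = linearGerms G from h] at hmem
  obtain ⟨A, hA, hAψ⟩ := hmem
  exact ⟨A, hA, Germ.coe_eq.1 hAψ⟩

theorem azeroEquiv_iff_gcongruent (h : CondDiff G) {f g : E n → E p} (hg : IsMapGerm g) :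
    AZeroEquiv G f g ↔ GCongruent G f g := by
  constructor
  · rintro ⟨φ, ψ, hφ, hψ, heq⟩
    obtain ⟨A, hA, hAψ⟩ := hψ.linear_of_condDiff h
    refine ⟨φ, hφ, A, hA, ?_⟩
    filter_upwards [heq, hg.tendsto.eventually hAψ] with x hx1 hx2
    rw [hx1, hx2]
  · rintro ⟨φ, hφ, A, hA, heq⟩
    have hmem : ((fun y : E p => (A : Matrix (Fin p) (Fin p) ℝ) *ᵥ y : E p → E p) : Gm p p) ∈
        DiffZero G := by
      rw [show DiffZero G = linearGerms G from h]
      exact ⟨A, hA, rfl⟩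
    obtain ⟨ψ, hψ, hAψ⟩ := hmem
    refine ⟨φ, ψ, hφ, hψ, ?_⟩
    filter_upwards [heq, hg.tendsto.eventually (Germ.coe_eq.1 hAψ)] with x hx1 hx2
    rw [hx1, ← hx2]

/-! ### A quadratic fixed-point equation -/

section QuadraticEquation

variable {F V : Type*} [NormedAddCommGroup F] [NormedSpace ℝ F] [NormedAddCommGroup V]
  [NormedSpace ℝ V]

/-- The equation `w = K y + s J(P(w, w))`, with `P` bilinear, has a small solution depending
analytically on `y` and `s`. -/
theorem exists_analytic_solution [CompleteSpace V] (K : F →L[ℝ] V) (J : V →L[ℝ] V) (P : V →L[ℝ] V →L[ℝ] V) :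
    ∃ w : F × ℝ → V, ContDiffAt ℝ ω w 0 ∧
      (∀ᶠ z in 𝓝 (0 : F × ℝ),
        w z = K z.1 + z.2 • J (P (w z) (w z))) ∧
      ∀ᶠ s in 𝓝 (0 : ℝ), w (0, s) = 0 := by
  -- Keeping s as a coordinate makes the derivative at the origin the identity; the solution is the
  -- second component of the local inverse at (s, K y).
  let Φ : ℝ × V → ℝ × V := fun z =>
    (z.1, z.2 - z.1 • J (P z.2 z.2))
  have hfst : ContDiff ℝ ω fun z : ℝ × V => z.1 := contDiff_fst
  have hsnd : ContDiff ℝ ω fun z : ℝ × V => z.2 := contDiff_snd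
  have hP : ContDiff ℝ ω fun z : ℝ × V => P z.2 :=
    P.contDiff.comp hsnd
  have hN : ContDiff ℝ ω fun z : ℝ × V => J (P z.2 z.2) :=
    J.contDiff.comp (hP.clm_apply hsnd)
  have hΦ : ContDiff ℝ ω Φ := hfst.prodMk (hsnd.sub (hfst.smul hN))
  have hω : (ω : WithTop ℕ∞) ≠ 0 := by simp
  let e : (ℝ × V) ≃L[ℝ] (ℝ × V) := ContinuousLinearEquiv.refl ℝ (ℝ × V)
  have hd : HasFDerivAt Φ (e : (ℝ × V) →L[ℝ] (ℝ × V)) 0 := by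
    have h1 : HasFDerivAt (fun z : ℝ × V => z.1) (ContinuousLinearMap.fst ℝ ℝ V) 0 := hasFDerivAt_fst
    have h2 : HasFDerivAt (fun z : ℝ × V => z.2) (ContinuousLinearMap.snd ℝ ℝ V) 0 := hasFDerivAt_snd
    have h3 : HasFDerivAt (fun z : ℝ × V => J (P z.2 z.2)) _ 0 :=
      ((hN.differentiable hω) 0).hasFDerivAt
    refine (h1.prodMk (h2.sub (h1.smul h3))).congr_fderiv ?_
    refine ContinuousLinearMap.ext fun z => ?_
    simp [e]
  have hstrict := hΦ.contDiffAt.hasStrictFDerivAt' hd hω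
  have hΦ0 : Φ 0 = 0 := by simp [Φ]
  set Θ := hΦ.contDiffAt.localInverse hd hω with hΘ
  have hinv : ContDiffAt ℝ ω Θ 0 := by
    have := hΦ.contDiffAt.to_localInverse hd hω
    rwa [hΦ0] at this
  have hleft : ∀ᶠ z in 𝓝 (0 : ℝ × V), Θ (Φ z) = z := hstrict.eventually_left_inverse
  have hright : ∀ᶠ z in 𝓝 (0 : ℝ × V), Φ (Θ z) = z := by
    have := hstrict.eventually_right_inverse
    rwa [hΦ0] at this
  have hι : ContDiff ℝ ω fun z : F × ℝ => ((z.2, K z.1) : ℝ × V) :=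
    contDiff_snd.prodMk (K.contDiff.comp contDiff_fst)
  have hι0 : Tendsto (fun z : F × ℝ => ((z.2, K z.1) : ℝ × V)) (𝓝 0) (𝓝 0) :=
    hι.continuous.tendsto' _ _ (by simp)
  refine ⟨fun z => (Θ (z.2, K z.1)).2, ?_, ?_, ?_⟩
  · refine contDiffAt_snd.comp _ (ContDiffAt.comp (0 : F × ℝ) ?_ hι.contDiffAt)
    have h0 : (((0 : F × ℝ).2, K (0 : F × ℝ).1) : ℝ × V) = 0 := by simp
    rw [h0]
    exact hinv
  · filter_upwards [hι0.eventually hright] with z hz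
    have h1 : (Θ (z.2, K z.1)).1 = z.2 := congrArg Prod.fst hz
    have h2 := congrArg Prod.snd hz
    simp only [Φ, h1] at h2
    exact eq_add_of_sub_eq h2
  · have hs : Tendsto (fun s : ℝ => ((s, 0) : ℝ × V)) (𝓝 0) (𝓝 0) :=
      (by fun_prop : Continuous fun s : ℝ => ((s, 0) : ℝ × V)).tendsto' _ _ rfl
    filter_upwards [hs.eventually hleft] with s hs
    have h1 : Φ (s, 0) = (s, 0) := by simp [Φ]
    rw [h1] at hs
    simp [hs]

theorem fderiv_solution {K : F →L[ℝ] V} {J : V →L[ℝ] V} {P : V →L[ℝ] V →L[ℝ] V}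
    (hP : ∀ u v, P u v = P v u) {W : F → V} {y : F}
    {s : ℝ} (hW : DifferentiableAt ℝ W y)
    (heq : ∀ᶠ x in 𝓝 y, W x = K x + s • J (P (W x) (W x))) (v : F) :
    fderiv ℝ W y v =
      K v + (2 * s) • J (P (W y) (fderiv ℝ W y v)) := by
  have h1 := P.hasFDerivAt_of_bilinear hW.hasFDerivAt hW.hasFDerivAt
  have h2 := (K.hasFDerivAt (x := y)).add
    ((J.hasFDerivAt.comp y h1).const_smul s)
  have h3 := (h2.congr_of_eventuallyEq heq).fderiv
  have hsymm : P (fderiv ℝ W y v) (W y) = P (W y) (fderiv ℝ W y v) :=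
    hP _ _
  have h4 := DFunLike.congr_fun h3 v
  refine h4.trans ?_
  simp [hsymm, mul_smul, two_smul]

/-- Since W(εv)/ε tends to K v, the quadratic term divided by ε² converges; this reads off the
second-order part of `W`. -/
theorem tendsto_solution {K : F →L[ℝ] V} {J : V →L[ℝ] V} {P : V →L[ℝ] V →L[ℝ] V}
    (hP : ∀ u v, P u v = P v u) {W : F → V} {s : ℝ} (hW : DifferentiableAt ℝ W 0) (hW0 : W 0 = 0)
    (heq : ∀ᶠ x in 𝓝 0, W x = K x + s • J (P (W x) (W x))) (v : F) :
    Tendsto (fun ε : ℝ => (ε ^ 2)⁻¹ • (W (ε • v) - K (ε • v))) (𝓝[≠] 0)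
      (𝓝 (s • J (P (K v) (K v)))) := by
  have hD : fderiv ℝ W 0 v = K v := by
    rw [fderiv_solution hP hW heq v, hW0]
    simp
  have hline : HasDerivAt (fun ε : ℝ => ε • v) v 0 := by
    simpa using (hasDerivAt_id (0 : ℝ)).smul_const v
  have hder : HasDerivAt (fun ε : ℝ => W (ε • v)) (K v) 0 := by
    have h1 : HasFDerivAt W (fderiv ℝ W 0) ((0 : ℝ) • v) := by
      rw [zero_smul]
      exact hW.hasFDerivAt
    rw [← hD]
    exact h1.comp_hasDerivAt (f := fun ε : ℝ => ε • v) 0 hline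
  have hslope : Tendsto (fun ε : ℝ => ε⁻¹ • W (ε • v)) (𝓝[≠] 0) (𝓝 (K v)) := by
    exact (hasDerivAt_iff_tendsto_slope.1 hder).congr fun ε => by simp [slope_def_module, hW0]
  have hcont : Continuous fun u : V => s • J (P u u) := by fun_prop
  have h0 : Tendsto (fun ε : ℝ => ε • v) (𝓝[≠] 0) (𝓝 0) :=
    (hline.continuousAt.tendsto.mono_left nhdsWithin_le_nhds).trans (by simp)
  refine ((hcont.tendsto (K v)).comp hslope).congr' ?_
  filter_upwards [h0.eventually heq] with ε hε
  rw [sub_eq_of_eq_add' hε]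
  simp only [Function.comp_apply, map_smul, smul_apply, smul_smul]
  congr 1
  ring

end QuadraticEquation

/-! ### Integral equations on path space -/

section Flow

open unitInterval

theorem continuous_comp_projIcc {F : Type*} [NormedAddCommGroup F] (v : C(I, F)) :
    Continuous fun ρ : ℝ => v (projIcc 0 1 zero_le_one ρ) :=
  v.continuous.comp continuous_projIcc

variable {F : Type*} [NormedAddCommGroup F] [NormedSpace ℝ F]

/-- Integration `v ↦ (r ↦ ∫₀ʳ v)` on `C([0,1], F)`. -/
noncomputable def primitiveL (F : Type*) [NormedAddCommGroup F] [NormedSpace ℝ F] :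
    C(I, F) →L[ℝ] C(I, F) :=
  LinearMap.mkContinuous
    { toFun := fun v =>
        ⟨fun r => ∫ ρ in (0 : ℝ)..r, v (projIcc 0 1 zero_le_one ρ),
          (intervalIntegral.continuous_primitive
            (fun a b => (continuous_comp_projIcc v).intervalIntegrable a b) 0).comp
            continuous_subtype_val⟩
      map_add' := fun u v => by
        ext r
        exact intervalIntegral.integral_add ((continuous_comp_projIcc u).intervalIntegrable _ _)
          ((continuous_comp_projIcc v).intervalIntegrable _ _)
      map_smul' := fun c v => by
        ext r
        exact intervalIntegral.integral_smul c _ } 1 (by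
    intro v
    rw [one_mul]
    refine (ContinuousMap.norm_le _ (norm_nonneg v)).2 fun r => ?_
    refine (intervalIntegral.norm_integral_le_of_norm_le_const
      (C := ‖v‖) fun ρ _ => v.norm_coe_le_norm _).trans ?_
    rw [sub_zero, abs_of_nonneg r.2.1]
    exact mul_le_of_le_one_right (norm_nonneg v) r.2.2)

theorem primitiveL_apply (v : C(I, F)) (r : I) :
    primitiveL F v r = ∫ ρ in (0 : ℝ)..r, v (projIcc 0 1 zero_le_one ρ) := rfl

/-- The bilinear map on `C([0,1], F)` given by pointwise application of `B`. -/
noncomputable def pointwiseL (B : F →L[ℝ] F →L[ℝ] F) : C(I, F) →L[ℝ] C(I, F) →L[ℝ] C(I, F) :=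
  LinearMap.mkContinuous₂
    (LinearMap.mk₂ ℝ (fun u v : C(I, F) =>
        (⟨fun r => B (u r) (v r), by fun_prop⟩ : C(I, F)))
      (fun u u' v => by ext r; simp) (fun c u v => by ext r; simp)
      (fun u v v' => by ext r; simp) (fun c u v => by ext r; simp)) ‖B‖ (by
    intro u v
    refine (ContinuousMap.norm_le _ (by positivity)).2 fun r => ?_
    refine (B.le_opNorm₂ _ _).trans ?_
    gcongr
    · exact u.norm_coe_le_norm r
    · exact v.norm_coe_le_norm r)

theorem pointwiseL_apply (B : F →L[ℝ] F →L[ℝ] F) (u v : C(I, F)) (r : I) :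
    pointwiseL B u v r = B (u r) (v r) := rfl

/-- Constant paths. -/
noncomputable def constL (F : Type*) [NormedAddCommGroup F] [NormedSpace ℝ F] :
    F →L[ℝ] C(I, F) :=
  LinearMap.mkContinuous
    { toFun := fun v => ContinuousMap.const I v
      map_add' := fun _ _ => rfl
      map_smul' := fun _ _ => rfl } 1 (by
    intro v
    rw [one_mul]
    exact (ContinuousMap.norm_le _ (norm_nonneg v)).2 fun r => le_rfl)

theorem constL_apply (v : F) (r : I) : constL F v r = v := rfl

/-- Evaluating the linearised integral equation at time t gives the variational equation a' = B(2s
w) a, whose coefficient is again a value of `B`. -/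
theorem hasDerivWithinAt_fderiv_flow [FiniteDimensional ℝ F] {B : F →L[ℝ] F →L[ℝ] F}
    {w : C(I, F)} {D : F →L[ℝ] C(I, F)} {s : ℝ}
    (hD : ∀ v, D v = constL F v + (2 * s) • primitiveL F (pointwiseL B w (D v))) :
    ∃ a X : ℝ → F →L[ℝ] F, Continuous a ∧ Continuous X ∧ a 0 = 1 ∧ (∀ v, a 1 v = D v 1) ∧
      (∀ t, ∃ u, X t = B u) ∧
      ∀ t ∈ Ico (0 : ℝ) 1, HasDerivWithinAt a (X t * a t) (Ioi t) t := by
  have : CompleteSpace F := FiniteDimensional.complete ℝ F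
  let π : ℝ → I := projIcc 0 1 zero_le_one
  have hπ : Continuous π := continuous_projIcc
  let a : ℝ → F →L[ℝ] F := fun t => (ContinuousMap.evalCLM ℝ (π t)).comp D
  let X : ℝ → F →L[ℝ] F := fun t => B ((2 * s) • w (π t))
  -- In finite dimension, pointwise continuity suffices for continuity in operator norm.
  have ha : Continuous a := continuous_clm_apply.2 fun v => (D v).continuous.comp hπ
  have hX : Continuous X := B.continuous.comp ((w.continuous.comp hπ).const_smul _)
  have hXa : Continuous fun t => X t * a t := hX.mul ha
  have hint : ∀ t ∈ Icc (0 : ℝ) 1, a t = 1 + ∫ ρ in (0 : ℝ)..t, X ρ * a ρ := by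
    intro t ht
    ext1 v
    have h1 : a t v = D v ⟨t, ht⟩ := by
      change D v (π t) = _
      simp only [π, projIcc_of_mem _ ht]
    have h2 : (∫ ρ in (0 : ℝ)..t, X ρ * a ρ) v = ∫ ρ in (0 : ℝ)..t, (X ρ * a ρ) v :=
      ContinuousLinearMap.intervalIntegral_apply (hXa.intervalIntegrable _ _) v
    rw [h1, hD]
    refine Eq.trans ?_ (congrArg (v + ·) h2).symm
    change v + (2 * s) • primitiveL F (pointwiseL B w (D v)) ⟨t, ht⟩ = v + _
    rw [primitiveL_apply, ← intervalIntegral.integral_smul]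
    congr 1
    refine intervalIntegral.integral_congr fun ρ _ => ?_
    simp [X, a, π, pointwiseL_apply]
  refine ⟨a, X, ha, hX, ?_, fun v => ?_, fun t => ⟨_, rfl⟩, fun t ht => ?_⟩
  · rw [hint 0 (by simp)]
    simp
  · change D v (π 1) = _
    simp [π]
  · have h := ((hXa.integral_hasStrictDerivAt 0 t).hasDerivAt.const_add 1).hasDerivWithinAt
      (s := Ioi t)
    refine h.congr_of_eventuallyEq ?_ (hint t ⟨ht.1, ht.2.le⟩)
    filter_upwards [Ioo_mem_nhdsGT ht.2] with r hr
    exact hint r ⟨ht.1.trans hr.1.le, hr.2.le⟩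

end Flow

/-! ### Integrating an element of the prolongation -/

open unitInterval in
/-- A symmetric bilinear map in the first prolongation integrates to a one-parameter family of
germs whose Jacobi matrices lie in `G`. -/
theorem exists_analytic_family (hclosed : IsClosed (G : Set (GL (Fin p) ℝ)))
    {B : E p →L[ℝ] E p →L[ℝ] E p} (hs : ∀ u v, B u v = B v u) (hB : ∀ u, B u ∈ endLie G) :
    ∃ ψ : E p × ℝ → E p, ContDiffAt ℝ ω ψ 0 ∧ (∀ᶠ y in 𝓝 (0 : E p), ψ (y, 0) = y) ∧
      (∀ᶠ s in 𝓝 (0 : ℝ), ψ (0, s) = 0) ∧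
      (∀ᶠ z in 𝓝 (0 : E p × ℝ), fderiv ℝ (fun y => ψ (y, z.2)) z.1 ∈ endG G) ∧
      ∀ᶠ s in 𝓝 (0 : ℝ), ∀ v, Tendsto (fun ε : ℝ => (ε ^ 2)⁻¹ • (ψ (ε • v, s) - ε • v))
        (𝓝[≠] 0) (𝓝 (s • B v v)) := by
  -- The equation reads w(r) = y + s ∫₀ʳ B(w, w): the flow of B(y, y), with time rescaled by s. The
  -- germ ψ is its value at r = 1.
  obtain ⟨w, hw, heq, hw0⟩ :=
    exists_analytic_solution (constL (E p)) (primitiveL (E p)) (pointwiseL B)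
  have hP : ∀ u v, pointwiseL B u v = pointwiseL B v u := fun u v => by
    ext1 r
    exact hs _ _
  let ev : C(I, E p) →L[ℝ] E p := ContinuousMap.evalCLM ℝ 1
  let ψ : E p × ℝ → E p := fun z => ev (w z)
  have hwd : ∀ᶠ z in 𝓝 (0 : E p × ℝ), DifferentiableAt ℝ w z :=
    (hw.eventually (by simp)).mono fun z hz => hz.differentiableAt (by simp)
  have hslice : ∀ z : E p × ℝ, HasFDerivAt (fun y : E p => (y, z.2))
      (ContinuousLinearMap.inl ℝ (E p) ℝ) z.1 := fun z => hasFDerivAt_prodMk_left z.1 z.2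
  have hslt : ∀ z : E p × ℝ, Tendsto (fun y : E p => (y, z.2)) (𝓝 z.1) (𝓝 z) := fun z =>
    (hslice z).continuousAt.tendsto
  have hs0 : Tendsto (fun s : ℝ => ((0, s) : E p × ℝ)) (𝓝 0) (𝓝 0) :=
    (by fun_prop : Continuous fun s : ℝ => ((0, s) : E p × ℝ)).tendsto' _ _ rfl
  have hwslice : ∀ z, DifferentiableAt ℝ w z → DifferentiableAt ℝ (fun y => w (y, z.2)) z.1 :=
    fun z hz => DifferentiableAt.comp (g := w) z.1 hz (hslice z).differentiableAt
  have hψ : ContDiffAt ℝ ω ψ 0 := ev.contDiff.contDiffAt.comp 0 hw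
  have hψ0 : ∀ᶠ y in 𝓝 (0 : E p), ψ (y, 0) = y := by
    filter_upwards [(hslt (0, 0)).eventually heq] with y hy
    change w (y, 0) 1 = y
    rw [hy, zero_smul, add_zero]
    rfl
  refine ⟨ψ, hψ, hψ0, ?_, ?_, ?_⟩
  · filter_upwards [hw0] with s hs
    change ev (w (0, s)) = 0
    rw [hs, map_zero]
  · have hfd : ∀ z, DifferentiableAt ℝ ψ z → fderiv ℝ (fun y => ψ (y, z.2)) z.1 =
        (fderiv ℝ ψ z).comp (ContinuousLinearMap.inl ℝ (E p) ℝ) := fun z hz =>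
      (HasFDerivAt.comp (g := ψ) z.1 hz.hasFDerivAt (hslice z)).fderiv
    have hψd : ∀ᶠ z in 𝓝 (0 : E p × ℝ), DifferentiableAt ℝ ψ z :=
      hwd.mono fun z hz => ev.differentiableAt.comp z hz
    -- Gronwall gives only the closure of `G`; invertibility follows by continuity from the identity
    -- Jacobian at the origin.
    have hunit : ∀ᶠ z in 𝓝 (0 : E p × ℝ),
        IsUnit ((fderiv ℝ ψ z).comp (ContinuousLinearMap.inl ℝ (E p) ℝ)) := by
      have h1 : (fderiv ℝ ψ 0).comp (ContinuousLinearMap.inl ℝ (E p) ℝ) = 1 := by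
        rw [← hfd 0 hψd.self_of_nhds]
        exact ((hasFDerivAt_id (𝕜 := ℝ) (0 : E p)).congr_of_eventuallyEq hψ0).fderiv
      have h2 : ContinuousAt (fun z => (fderiv ℝ ψ z).comp (ContinuousLinearMap.inl ℝ (E p) ℝ))
          0 := ((hψ.fderiv_right (m := ω) le_top).continuousAt).clm_comp continuousAt_const
      have h3 := Units.isOpen.mem_nhds (isUnit_one (M := E p →L[ℝ] E p))
      rw [← h1] at h3
      exact h2.eventually h3
    filter_upwards [heq.eventually_nhds, hwd, hunit, hψd] with z hz hzd hzu hzψ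
    have hD := fderiv_solution hP (hwslice z hzd) ((hslt z).eventually hz)
    obtain ⟨a, X, ha, hX, ha0, ha1, hXB, hode⟩ := hasDerivWithinAt_fderiv_flow hD
    obtain ⟨C, hC⟩ := isCompact_Icc.exists_bound_of_continuousOn (s := Icc (0 : ℝ) 1)
      hX.continuousOn
    have hcl := mem_closure_of_hasDerivWithinAt (G := G) ha.continuousOn hode
      (fun t _ => by
        obtain ⟨u, hu⟩ := hXB t
        rw [hu]
        exact hB u)
      (fun t ht => hC t (Ico_subset_Icc_self ht)) (by rw [ha0]; exact one_mem_endG) 1 (by simp)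
    have heval : a 1 = fderiv ℝ (fun y => ψ (y, z.2)) z.1 := by
      ext1 v
      rw [ha1, HasFDerivAt.fderiv (f := fun y => ψ (y, z.2))
        (ev.hasFDerivAt.comp z.1 (hwslice z hzd).hasFDerivAt)]
      rfl
    rw [← heval]
    rw [← hfd z hzψ, ← heval] at hzu
    exact mem_endG_of_mem_closure hclosed hcl hzu
  · filter_upwards [hs0.eventually heq.eventually_nhds, hs0.eventually hwd, hw0] with s h1 h2 h3 v
    have h4 := tendsto_solution hP (hwslice (0, s) h2) h3 ((hslt (0, s)).eventually h1) v
    have h5 := (ev.continuous.tendsto _).comp h4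
    have h6 : ev (s • primitiveL (E p) (pointwiseL B (constL (E p) v) (constL (E p) v))) =
        s • B v v := by
      rw [map_smul]
      congr 1
      change primitiveL (E p) _ 1 = _
      rw [primitiveL_apply]
      simp [pointwiseL_apply, constL_apply]
    rw [h6] at h5
    refine h5.congr fun ε => ?_
    simp only [Function.comp_apply, map_smul, map_sub]
    rfl

/-- If the flow germ is linear, given by `A`, its second-order quotient is (A v - v)/ε. Convergence
forces A v = v, so the limit, a positive multiple of B(v, v), is zero. -/
theorem hasTrivialProlongation_of_condDiff (hclosed : IsClosed (G : Set (GL (Fin p) ℝ)))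
    (h : CondDiff G) : HasTrivialProlongation G := by
  intro B hs hB
  obtain ⟨ψ, hψ, hψ0, hψz, hψG, hψt⟩ := exists_analytic_family hclosed hs hB
  have hs0 : Tendsto (fun s : ℝ => ((0, s) : E p × ℝ)) (𝓝 0) (𝓝 0) :=
    (by fun_prop : Continuous fun s : ℝ => ((0, s) : E p × ℝ)).tendsto' _ _ rfl
  obtain ⟨r, hr, hball⟩ := Metric.eventually_nhds_iff.1
    ((hs0.eventually hψG.eventually_nhds).and
      ((hs0.eventually (hψ.eventually (by simp))).and (hψz.and hψt)))
  have hdiff : ∀ s : ℝ, dist s 0 < r → IsDiffG G fun y => ψ (y, s) := by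
    intro s hsr
    obtain ⟨h1, h2, h3, -⟩ := hball hsr
    have hslt : Tendsto (fun y : E p => (y, s)) (𝓝 0) (𝓝 (0, s)) :=
      (by fun_prop : Continuous fun y : E p => (y, s)).tendsto' _ _ rfl
    exact isDiffG_of_analytic
      (ContDiffAt.comp (g := ψ) (0 : E p) h2 (contDiff_id.prodMk contDiff_const).contDiffAt) h3
      (hslt.eventually h1)
  have hsmall : ∀ t ∈ Icc (0 : ℝ) 1, dist (t * (r / 2)) 0 < r := by
    intro t ht
    rw [dist_zero_right, Real.norm_eq_abs, abs_of_nonneg (mul_nonneg ht.1 (by positivity))]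
    nlinarith [ht.2]
  have hhalf : dist (r / 2) 0 < r := by simpa using hsmall 1 (by simp)
  -- The isotopy runs the flow to time r/2, so the closed parameter interval stays inside the ball
  -- of radius r.
  have hzero : IsDiffZeroG G fun y => ψ (y, r / 2) := by
    refine ⟨hdiff _ hhalf, fun z => ψ (z.1, z.2 * (r / 2)), ?_, fun t ht => hdiff _ (hsmall t ht),
      ?_, ?_⟩
    · rw [eventually_nhdsSet_iff_forall]
      rintro ⟨y, t⟩ ⟨rfl, ht⟩
      have h2 : ContDiffAt ℝ ω (fun z : E p × ℝ => ψ (z.1, z.2 * (r / 2))) (0, t) :=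
        ContDiffAt.comp (g := ψ) ((0, t) : E p × ℝ) (hball (hsmall t ht)).2.1
          (contDiff_fst.prodMk (contDiff_snd.mul contDiff_const)).contDiffAt
      exact (h2.eventually (by simp)).mono fun z hz => hz.of_le le_top
    · simpa using hψ0
    · exact Eventually.of_forall fun y => by simp
  obtain ⟨A, -, hA⟩ := hzero.linear_of_condDiff h
  refine eq_zero_of_diagonal hs fun v => ?_
  have hlim := (hball hhalf).2.2.2 v
  have hline : Tendsto (fun ε : ℝ => ε • v) (𝓝[≠] 0) (𝓝 0) :=
    ((by fun_prop : Continuous fun ε : ℝ => ε • v).tendsto' 0 0 (by simp)).mono_left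
      nhdsWithin_le_nhds
  have hlin : Tendsto (fun ε : ℝ => ε⁻¹ • (toL p (A : Matrix (Fin p) (Fin p) ℝ) v - v))
      (𝓝[≠] 0) (𝓝 ((r / 2) • B v v)) := by
    refine hlim.congr' ?_
    filter_upwards [hline.eventually hA, self_mem_nhdsWithin] with ε hε hne
    have hne' : ε ≠ 0 := hne
    rw [hε, ← toL_apply, map_smul, ← smul_sub, smul_smul]
    congr 1
    field_simp
  have hid : Tendsto (fun ε : ℝ => ε) (𝓝[≠] 0) (𝓝 0) := nhdsWithin_le_nhds
  have hAv : toL p (A : Matrix (Fin p) (Fin p) ℝ) v - v = 0 := by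
    have h1 := hid.smul hlin
    rw [zero_smul] at h1
    refine tendsto_nhds_unique (tendsto_const_nhds.congr' ?_) h1
    filter_upwards [self_mem_nhdsWithin] with ε hne
    have hne' : ε ≠ 0 := hne
    rw [smul_smul, mul_inv_cancel₀ hne', one_smul]
  rw [hAv] at hlin
  simp only [smul_zero] at hlin
  have h0 := tendsto_nhds_unique hlin tendsto_const_nhds
  exact (smul_eq_zero.1 h0).resolve_left (by positivity)

end GeomEquiv

theorem corollary7p2 {p : ℕ} (G : Subgroup (Matrix.GeneralLinearGroup (Fin p) ℝ))
    (hclosed : IsClosed (G : Set (Matrix.GeneralLinearGroup (Fin p) ℝ)))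
    (hconn : IsConnected (G : Set (Matrix.GeneralLinearGroup (Fin p) ℝ)))
    (hG : GeomEquiv.CondIso G ∨ GeomEquiv.CondLinear G ∨ GeomEquiv.CondDiff G) (n : ℕ) :
    (∀ (f : GeomEquiv.E n → GeomEquiv.E p) (hf : GeomEquiv.IsMapGerm f),
      GeomEquiv.tangentA G f hf = GeomEquiv.tangentRG G f) ∧
    (∀ f g : GeomEquiv.E n → GeomEquiv.E p, GeomEquiv.IsMapGerm f → GeomEquiv.IsMapGerm g →
      (GeomEquiv.AZeroEquiv G f g ↔ GeomEquiv.GCongruent G f g)) := by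
  have htriv : GeomEquiv.HasTrivialProlongation G := by
    rcases hG with h | h | h
    · refine GeomEquiv.hasTrivialProlongation_of_condLinear ?_
      exact GeomEquiv.condLinear_of_thetaG_eq (GeomEquiv.thetaG_eq_of_condIso h)
    · exact GeomEquiv.hasTrivialProlongation_of_condLinear h
    · exact GeomEquiv.hasTrivialProlongation_of_condDiff hclosed h
  exact ⟨GeomEquiv.tangentA_eq_tangentRG
      (le_antisymm (GeomEquiv.thetaG_le_of_trivial htriv) GeomEquiv.map_actMap_id_le),
    fun f g _ hg => GeomEquiv.azeroEquiv_iff_gcongruent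
      (GeomEquiv.diffZero_eq_linearGerms hclosed hconn htriv) hg⟩
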